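/- Let $n\ge 1$, let $B=\mathbb{C}[X_1,\dots,X_n]$ be graded by giving $X_i$ a weight $b_i>0$, let $f_1,\dots,f_n\in B$ be weighted homogeneous, of weights $a_1,\dots,a_n$, and let $A=\mathbb{C}[f_1,\dots,f_n]\subseteq B$. Assume that $A\subseteq B$ is a finite graded polynomial extension, i.e. that $B$ is a finitely generated $A$-module, and let $r$ be the rank of $B$ over $A$. Let $f:V=\mathbb{C}^n\to U=\mathbb{C}^n$ be the map $x\mapsto(f_1(x),\dots,f_n(x))$ and $J=\det(\partial f_i/\partial X_j)$ its Jacobian. Write $\operatorname{Spec}_1(R)$ for the set of prime ideals of height one of $R$. For $\mathfrak q=(Q)\in\operatorname{Spec}_1(B)$ over $\mathfrak q\cap A=(P)\in\operatorname{Spec}_1(A)$, let $e_Q=e_{\mathfrak q}$ be the exponent of $Q$ in the factorisation of $P$ in $B$; $\mathfrak q$ is ramified if $e_{\mathfrak q}>1$. Let $\operatorname{Spec}_1^{\mathrm{ram}}(B)$ be the set of ramified primes in $\operatorname{Spec}_1(B)$; products over $Q\in\operatorname{Spec}_1^{\mathrm{ram}}(B)$ take one generator $Q$ for each such prime. The ramification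 locus is $V_{\mathrm{ram}}=\{v\in V: J(v)=0\}$, and the branch locus is $U_{\mathrm{branch}}=\{u\in U: |f^{-1}(u)|<r\}$. Then $\operatorname{Spec}_1^{\mathrm{ram}}(B)$ is finite, and the following properties are equivalent: (i) $A\subseteq B$ is well-ramified, i.e. $(J)\cap A=\left(\prod_{Q\in\operatorname{Spec}_1^{\mathrm{ram}}(B)}Q^{e_Q}\right)$; (ii) $\left(\prod_{Q\in\operatorname{Spec}_1^{\mathrm{ram}}(B)}Q\right)\cap A=\left(\prod_{Q\in\operatorname{Spec}_1^{\mathrm{ram}}(B)}Q^{e_Q}\right)$; (iii) $\prod_{Q\in\operatorname{Spec}_1^{\mathrm{ram}}(B)}Q^{e_Q}$ lies in $A$; (iv) for every $\mathfrak p\in\operatorname{Spec}_1(A)$, if some $\mathfrak q_0\in\operatorname{Spec}_1(B)$ over $\mathfrak p$ is ramified, then every $\mathfrak q\in\operatorname{Spec}_1(B)$ over $\mathfrak p$ is ramified; (v) every irreducible element $P$ of $A$ is, as an element of $B$, either reduced (squarefree) or completely non-reduced, i.e. each of its irreducible factors in $B$ appears at least twice; (vi) $f^{-1}(U_{\mathrm{branch}})=V_{\mathrm{ram}}$;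 (vii) $f(V_{\mathrm{ram}})\cap f(V-V_{\mathrm{ram}})=\varnothing$. In (i) and (ii), on the left $(\cdot)$ denotes an ideal of $B$, and on the right it denotes the set of $A$-multiples, so that the equality is one of ideals of $A$ (and contains the assertion that the generator on the right lies in $A$). -/

import Mathlib

noncomputable section

namespace PolyExt

open MvPolynomial

variable {n : ℕ}

/-- The subalgebra `A = ℂ[f₁, …, fₙ]` of `B = ℂ[X₁, …, Xₙ]`. -/
abbrev subalg (f : Fin n → MvPolynomial (Fin n) ℂ) :
    Subalgebra ℂ (MvPolynomial (Fin n) ℂ) :=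
  Algebra.adjoin ℂ (Set.range f)

/-- `A = ℂ[f₁, …, fₙ] ⊆ B = ℂ[X₁, …, Xₙ]` is a finite graded polynomial extension: `Xᵢ` has
weight `bᵢ > 0`, each `fᵢ` is weighted homogeneous of weight `aᵢ`, and `B` is a finitely generated
`A`-module. -/
structure IsFiniteGraded (b a : Fin n → ℕ) (f : Fin n → MvPolynomial (Fin n) ℂ) : Prop where
  weight_pos : ∀ i, 0 < b i
  homogeneous : ∀ i, IsWeightedHomogeneous b (f i) (a i)
  finite : Module.Finite (subalg f) (MvPolynomial (Fin n) ℂ)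

/-- The set `Spec₁(R)` of prime ideals of height one. -/
def Spec1 (R : Type*) [CommRing R] : Set (Ideal R) :=
  {q | q.IsPrime ∧ q.height = 1}

/-- The ramification index `e_q` of `q` over `p = q ∩ A`: the largest `k` with `p B ⊆ q ^ k`.
If `q = (Q)` and `p = (P)`, this is the largest `k` such that `Q ^ k` divides `P`. -/
def ramIdx (f : Fin n → MvPolynomial (Fin n) ℂ) (q : Ideal (MvPolynomial (Fin n) ℂ)) : ℕ :=
  Ideal.ramificationIdx' (q.under (subalg f)) q

/-- The set of ramified prime ideals of height one of `B`. -/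
def Spec1Ram (f : Fin n → MvPolynomial (Fin n) ℂ) : Set (Ideal (MvPolynomial (Fin n) ℂ)) :=
  {q | q ∈ Spec1 (MvPolynomial (Fin n) ℂ) ∧ 1 < ramIdx f q}

theorem isPrincipal_of_mem {f : Fin n → MvPolynomial (Fin n) ℂ}
    {q : Ideal (MvPolynomial (Fin n) ℂ)} (hq : q ∈ Spec1Ram f) :
    Submodule.IsPrincipal q :=
  haveI := hq.1.1
  UniqueFactorizationMonoid.isPrincipal_of_height_eq_one hq.1.2

/-- A polynomial `Q` generating the ramified prime ideal `q` of height one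
(it is unique up to a nonzero scalar). -/
def rep (f : Fin n → MvPolynomial (Fin n) ℂ) (q : Spec1Ram f) : MvPolynomial (Fin n) ℂ :=
  haveI := isPrincipal_of_mem q.2
  Submodule.IsPrincipal.generator q.1

theorem span_rep (f : Fin n → MvPolynomial (Fin n) ℂ) (q : Spec1Ram f) :
    Ideal.span {rep f q} = q.1 :=
  haveI := isPrincipal_of_mem q.2
  Ideal.span_singleton_generator q.1

/-- `∏ Q` over the ramified `Q`. -/
def ramProd (f : Fin n → MvPolynomial (Fin n) ℂ) : MvPolynomial (Fin n) ℂ :=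
  ∏ᶠ q : Spec1Ram f, rep f q

/-- `∏ Q ^ e_Q` over the ramified `Q`. -/
def ramPowProd (f : Fin n → MvPolynomial (Fin n) ℂ) : MvPolynomial (Fin n) ℂ :=
  ∏ᶠ q : Spec1Ram f, rep f q ^ ramIdx f q.1

/-- The Jacobian determinant `J` of `f`. -/
def jac (f : Fin n → MvPolynomial (Fin n) ℂ) : MvPolynomial (Fin n) ℂ :=
  Matrix.det (Matrix.of fun i j => pderiv j (f i))

/-- `(g) ∩ A = (h)` as ideals of `A`, where `(g) = g B` and `(h) = h A`. In particular
the equality forces `h` to lie in `A`. -/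
def ContractsTo (f : Fin n → MvPolynomial (Fin n) ℂ) (g h : MvPolynomial (Fin n) ℂ) : Prop :=
  (Ideal.span {g} : Set (MvPolynomial (Fin n) ℂ)) ∩ (subalg f : Set (MvPolynomial (Fin n) ℂ)) =
    (Submodule.span (subalg f) {h} : Set (MvPolynomial (Fin n) ℂ))

/-- The extension is well-ramified: `(J) ∩ A = (∏ Q ^ e_Q)`. -/
def WellRamified (f : Fin n → MvPolynomial (Fin n) ℂ) : Prop :=
  ContractsTo f (jac f) (ramPowProd f)

/-- The polynomial map `f : V = ℂⁿ → U = ℂⁿ`. -/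
def polyMap (f : Fin n → MvPolynomial (Fin n) ℂ) (v : Fin n → ℂ) : Fin n → ℂ :=
  fun i => eval v (f i)

/-- The degree `r` of the extension, i.e. the rank of `B` over `A`. -/
def degree (f : Fin n → MvPolynomial (Fin n) ℂ) : ℕ :=
  Module.finrank (subalg f) (MvPolynomial (Fin n) ℂ)

/-- The ramification locus: the set of zeros of the Jacobian. -/
def ramLocus (f : Fin n → MvPolynomial (Fin n) ℂ) : Set (Fin n → ℂ) :=
  {v | eval v (jac f) = 0}

/-- The branch locus: the set of points whose fibre has less than `r` elements. -/
def branchLocus (f : Fin n → MvPolynomial (Fin n) ℂ) : Set (Fin n → ℂ) :=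
  {u | (polyMap f ⁻¹' {u}).encard < (degree f : ℕ∞)}

/-- `P` is completely non-reduced: each of its irreducible factors appears at least twice. -/
def CompletelyNonReduced {R : Type*} [CommRing R] (P : R) : Prop :=
  ∀ Q : R, Irreducible Q → Q ∣ P → Q ^ 2 ∣ P

end PolyExt

end

noncomputable section

namespace PolyExt

open MvPolynomial

variable {n : ℕ}

/-! ### Partial derivatives -/

/-! Everything rests on two facts.

First, the order of `J` along a prime `Q` of `B` is exactly `e_Q - 1` (`jac_order`,
`pow_dvd_jac_iff`). So the ramified primes are the prime factors of `J`, finite in number, and `J`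
has the same zeros as `E = ∏ Q ^ e_Q`. An element of `A` divisible by every ramified `Q` is
divisible by `E`, so (i) and (ii) both amount to `E ∈ A`. If `E ∈ A`, a prime `P` of `A` with one
ramified factor divides `E`, so all its factors are ramified; conversely, under (iv), `E` is up to a
unit the product of the primes of `A` below the ramified ones. (v) rephrases (iv), since `Q ^ 2 ∣ P`
means that `Q` is ramified. If `E ∈ A`, then `E` is constant on fibres, which gives (vii);
lying-over and the Nullstellensatz give the converse.

Second, a fibre has fewer than `r` points exactly when it meets the ramification locus, for nonempty
fibres (`polyMap_mem_branchLocus`, `exists_mem_ramLocus`). So the preimage of the branch locus is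
the union of the fibres meeting the ramification locus, and (vi) is (vii).

The tool for both is that a derivation of `B` into a field, killing `A` and the kernel of the map to
that field, is zero, or a variant of its proof (`eq_zero_of_dir_eq_zero`). -/

theorem exists_pderiv_ne_zero {σ : Type*} {F : MvPolynomial σ ℂ} (hF : ∀ c, F ≠ C c) :
    ∃ i, pderiv i F ≠ 0 := by
  classical
  by_contra! h
  refine hF (coeff 0 F) (MvPolynomial.ext _ _ fun m => ?_)
  rw [coeff_C]
  split_ifs with hm
  · rw [hm]
  · obtain ⟨i, hi⟩ : ∃ i, m i ≠ 0 := by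
      by_contra! h0
      exact hm (Finsupp.ext fun i => (h0 i).symm)
    have hle : Finsupp.single i 1 ≤ m := by
      rw [Finsupp.single_le_iff]; omega
    have h1 := coeff_pderiv F (i := i) (m - Finsupp.single i 1)
    rw [h i, coeff_zero, tsub_add_cancel_of_le hle] at h1
    rcases mul_eq_zero.1 h1.symm with h2 | h2
    · exact h2
    · exact absurd h2 (Nat.cast_add_one_ne_zero _)

theorem totalDegree_pderiv_lt {σ : Type*} {F : MvPolynomial σ ℂ} {i : σ} (h : pderiv i F ≠ 0) :
    (pderiv i F).totalDegree < F.totalDegree := by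
  have key : ∀ m ∈ (pderiv i F).support, (m.sum fun _ e => e) < F.totalDegree := by
    intro m hm
    rw [mem_support_iff, coeff_pderiv] at hm
    have h1 := le_totalDegree (mem_support_iff.2 (left_ne_zero_of_mul hm))
    rw [Finsupp.sum_add_index' (by simp) (by simp), Finsupp.sum_single_index rfl] at h1
    omega
  obtain ⟨m, hm⟩ := support_nonempty.2 h
  exact (Finset.sup_lt_iff (by simpa using (key m hm).trans_le' (Nat.zero_le _))).2 key

/-! ### Directional derivatives along a ring homomorphism -/

section Dir

variable {σ : Type*} [Fintype σ] {L : Type*} [CommRing L]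

/-- The derivative of the polynomial `h` in the direction `w`, with values in `L`. -/
def dir (φ : MvPolynomial σ ℂ →+* L) (w : σ → L) (h : MvPolynomial σ ℂ) : L :=
  ∑ j, φ (pderiv j h) * w j

variable (φ : MvPolynomial σ ℂ →+* L) (w : σ → L)

theorem dir_add (g h : MvPolynomial σ ℂ) : dir φ w (g + h) = dir φ w g + dir φ w h := by
  simp [dir, add_mul, Finset.sum_add_distrib]

theorem dir_mul (g h : MvPolynomial σ ℂ) :
    dir φ w (g * h) = φ g * dir φ w h + φ h * dir φ w g := by
  simp only [dir, pderiv_mul, map_add, map_mul, Finset.mul_sum, ← Finset.sum_add_distrib]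
  exact Finset.sum_congr rfl fun j _ => by ring

theorem dir_C (c : ℂ) : dir φ w (C c) = 0 := by simp [dir]

theorem dir_zero : dir φ w 0 = 0 := by simp [dir]

theorem dir_X (j : σ) : dir φ w (X j) = w j := by
  classical
  simp [dir, pderiv_X, Pi.single_apply, apply_ite φ]

theorem dir_sub (g h : MvPolynomial σ ℂ) : dir φ w (g - h) = dir φ w g - dir φ w h := by
  simp [dir, sub_mul, Finset.sum_sub_distrib]

variable {φ w} in
theorem dir_eq_zero_of_mem_adjoin {s : Set (MvPolynomial σ ℂ)} (hs : ∀ g ∈ s, dir φ w g = 0)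
    {h : MvPolynomial σ ℂ} (hh : h ∈ Algebra.adjoin ℂ s) : dir φ w h = 0 := by
  induction hh using Algebra.adjoin_induction with
  | mem x hx => exact hs x hx
  | algebraMap r => exact dir_C φ w r
  | add x y _ _ hx hy => rw [dir_add, hx, hy, add_zero]
  | mul x y _ _ hx hy => rw [dir_mul, hx, hy, mul_zero, mul_zero, add_zero]

variable {φ w} in
theorem dir_aeval {A : Subalgebra ℂ (MvPolynomial σ ℂ)} (hA : ∀ a ∈ A, dir φ w a = 0)
    (p : Polynomial A) (x : MvPolynomial σ ℂ) :
    dir φ w (Polynomial.aeval x p) =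
      φ (Polynomial.aeval x (Polynomial.derivative p)) * dir φ w x := by
  induction p using Polynomial.induction_on' with
  | add p q hp hq => simp only [map_add, dir_add, hp, hq, add_mul]
  | monomial k a =>
    have hpow : ∀ k : ℕ, dir φ w (x ^ k) = φ (k * x ^ (k - 1)) * dir φ w x := by
      intro k
      induction k with
      | zero => simpa using dir_C φ w 1
      | succ k ih =>
        rw [pow_succ, dir_mul, ih]
        rcases k with _ | k
        · simp
        · simp only [map_mul, map_pow, Nat.add_sub_cancel, pow_succ, Nat.cast_succ, map_add, map_one]
          ring
    rw [Polynomial.derivative_monomial, Polynomial.aeval_monomial, Polynomial.aeval_monomial,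
      dir_mul, hpow]
    change _ + _ * dir φ w (a : MvPolynomial σ ℂ) = _
    rw [hA a a.2, mul_zero, add_zero]
    simp only [map_mul, map_natCast, map_pow]
    ring

theorem dir_aeval_mv {τ : Type*} [Fintype τ] (f : τ → MvPolynomial σ ℂ) (F : MvPolynomial τ ℂ) :
    dir φ w (aeval f F) = ∑ i, φ (aeval f (pderiv i F)) * dir φ w (f i) := by
  classical
  induction F using MvPolynomial.induction_on with
  | C c => simpa using dir_C φ w c
  | add p q hp hq => simp only [map_add, dir_add, hp, hq, add_mul, Finset.sum_add_distrib]
  | mul_X p k hp =>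
    simp only [map_mul, dir_mul, hp, aeval_X, pderiv_mul, map_add, pderiv_X, add_mul,
      Finset.sum_add_distrib, Finset.mul_sum]
    rw [add_comm]
    congr 1
    · exact Finset.sum_congr rfl fun j _ => by ring
    · rw [Finset.sum_eq_single k]
      · simp
      · intro i _ hi
        simp [Pi.single_eq_of_ne' hi]
      · simp

end Dir

theorem pderiv_aeval {σ τ : Type*} [Fintype σ] [Fintype τ] (f : τ → MvPolynomial σ ℂ)
    (F : MvPolynomial τ ℂ) (j : σ) :
    pderiv j (aeval f F) = ∑ i, aeval f (pderiv i F) * pderiv j (f i) := by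
  classical
  have h : ∀ g : MvPolynomial σ ℂ, dir (RingHom.id _) (Pi.single j 1) g = pderiv j g := by
    intro g
    simp [dir, Pi.single_apply]
  rw [← h, dir_aeval_mv]
  simp [h]

/-- A derivation that kills `A` and factors through a field over which `B` is integral
vanishes. -/
theorem eq_zero_of_dir_eq_zero {σ : Type*} [Fintype σ] {L : Type*} [Field L]
    {φ : MvPolynomial σ ℂ →+* L} {w : σ → L} {A : Subalgebra ℂ (MvPolynomial σ ℂ)}
    [Algebra.IsIntegral A (MvPolynomial σ ℂ)] (hA : ∀ a ∈ A, dir φ w a = 0)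
    (hker : ∀ h, φ h = 0 → dir φ w h = 0) : w = 0 := by
  classical
  have : CharZero L := charZero_of_injective_ringHom (φ.comp C).injective
  funext j
  rw [Pi.zero_apply, ← dir_X φ w j]
  generalize (X j : MvPolynomial σ ℂ) = x
  -- Take a monic `p` of least degree with `φ (p(x)) = 0`. Applying the derivation gives `φ (p'(x))
  -- * dx = 0`; as `p'` divided by its leading coefficient is monic of smaller degree, the first
  -- factor is nonzero.
  have hex : ∃ d : ℕ, ∃ p : Polynomial A, p.Monic ∧ p.natDegree = d ∧
      φ (Polynomial.aeval x p) = 0 := by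
    obtain ⟨p, hp, hx⟩ := Algebra.IsIntegral.isIntegral (R := A) x
    refine ⟨_, p, hp, rfl, ?_⟩
    rw [Polynomial.aeval_def, hx, map_zero]
  obtain ⟨p, hp, hd, hx⟩ := Nat.find_spec hex
  have hmin := fun d => Nat.find_min hex (m := d)
  generalize Nat.find hex = d at hd hmin
  rcases d with _ | d
  · rw [hp.natDegree_eq_zero.1 hd] at hx
    simp at hx
  have h0 := hker _ hx
  rw [dir_aeval hA] at h0
  refine (mul_eq_zero.1 h0).resolve_left fun h1 => ?_
  have hdeg : (Polynomial.derivative p).natDegree ≤ d := by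
    have := Polynomial.natDegree_derivative_le p
    omega
  have hc : (Polynomial.C (algebraMap ℂ A ((d : ℂ) + 1)⁻¹) * Polynomial.derivative p).coeff d
      = 1 := by
    have h2 : p.coeff (d + 1) = 1 := by
      have := hp.coeff_natDegree
      rwa [hd] at this
    rw [Polynomial.coeff_C_mul, Polynomial.coeff_derivative, h2, one_mul]
    have h3 : ((d : A) + 1) = algebraMap ℂ A ((d : ℂ) + 1) := by simp
    rw [h3, ← map_mul, inv_mul_cancel₀ (by exact_mod_cast Nat.succ_ne_zero d), map_one]
  have hdeg' : (Polynomial.C (algebraMap ℂ A ((d : ℂ) + 1)⁻¹) *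
      Polynomial.derivative p).natDegree ≤ d :=
    (Polynomial.natDegree_C_mul_le _ _).trans hdeg
  refine hmin d d.lt_succ_self ⟨_, Polynomial.monic_of_natDegree_le_of_coeff_eq_one d hdeg' hc,
    le_antisymm hdeg' (Polynomial.le_natDegree_of_ne_zero (by rw [hc]; exact one_ne_zero)), ?_⟩
  rw [map_mul, map_mul, h1, mul_zero]

/-! ### The Jacobian and algebraic independence -/

/-- The Jacobian matrix of `f`. -/
def jacMatrix (f : Fin n → MvPolynomial (Fin n) ℂ) : Matrix (Fin n) (Fin n) (MvPolynomial (Fin n) ℂ) :=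
  Matrix.of fun i j => pderiv j (f i)

theorem map_jac {L : Type*} [CommRing L] (φ : MvPolynomial (Fin n) ℂ →+* L)
    (f : Fin n → MvPolynomial (Fin n) ℂ) :
    φ (jac f) = (φ.mapMatrix (jacMatrix f)).det := by
  rw [← RingHom.map_det]; rfl

/-- A kernel vector of the Jacobian matrix over `L` is a direction in which every `f i`, hence all
of `A`, has derivative zero. -/
theorem exists_dir_eq_zero {L : Type*} [Field L] (φ : MvPolynomial (Fin n) ℂ →+* L)
    {f : Fin n → MvPolynomial (Fin n) ℂ} (h : φ (jac f) = 0) :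
    ∃ w : Fin n → L, w ≠ 0 ∧ ∀ a ∈ subalg f, dir φ w a = 0 := by
  rw [map_jac, ← Matrix.exists_mulVec_eq_zero_iff] at h
  obtain ⟨w, hw, h⟩ := h
  refine ⟨w, hw, fun a ha => dir_eq_zero_of_mem_adjoin ?_ ha⟩
  rintro _ ⟨i, rfl⟩
  exact congrFun h i

section Finite

variable {f : Fin n → MvPolynomial (Fin n) ℂ} [Module.Finite (subalg f) (MvPolynomial (Fin n) ℂ)]

variable (f) in
theorem jac_ne_zero : jac f ≠ 0 := by
  intro h
  obtain ⟨w, hw, hA⟩ := exists_dir_eq_zero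
    (algebraMap (MvPolynomial (Fin n) ℂ) (FractionRing (MvPolynomial (Fin n) ℂ)))
    (f := f) (by rw [h, map_zero])
  refine hw (eq_zero_of_dir_eq_zero hA fun h hh => ?_)
  rw [(map_eq_zero_iff _ (IsFractionRing.injective _ _)).1 hh, dir_zero]

-- Differentiating a relation `F(f) = 0` puts the vector of the `(∂F/∂Yᵢ)(f)` in the left kernel of
-- the Jacobian matrix. As `J ≠ 0`, each `∂F/∂Yᵢ` is a relation of smaller degree.
variable (f) in
theorem algebraicIndependent : AlgebraicIndependent ℂ f := by
  rw [algebraicIndependent_iff]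
  suffices H : ∀ d : ℕ, ∀ F : MvPolynomial (Fin n) ℂ, F.totalDegree = d → aeval f F = 0 → F = 0 from
    fun F => H _ F rfl
  intro d
  induction d using Nat.strong_induction_on with
  | _ d ih =>
  intro F hd hF
  by_cases hc : ∃ c, F = C c
  · obtain ⟨c, rfl⟩ := hc
    simpa using hF
  push Not at hc
  obtain ⟨i, hi⟩ := exists_pderiv_ne_zero hc
  refine absurd ?_ hi
  refine ih _ (hd ▸ totalDegree_pderiv_lt hi) _ rfl ?_
  have h1 : Matrix.vecMul (fun i => aeval f (pderiv i F)) (jacMatrix f) = 0 := by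
    funext j
    have := pderiv_aeval f F j
    rw [hF, map_zero] at this
    simpa [Matrix.vecMul, dotProduct, jacMatrix] using this.symm
  by_contra h2
  exact jac_ne_zero f (Matrix.exists_vecMul_eq_zero_iff.1 ⟨_, fun h => h2 (congrFun h i), h1⟩)

end Finite

/-! ### Primes of height one -/

theorem mem_Spec1_iff {R : Type*} [CommRing R] [IsDomain R] [IsNoetherianRing R]
    [UniqueFactorizationMonoid R] {q : Ideal R} :
    q ∈ Spec1 R ↔ ∃ Q, Prime Q ∧ q = Ideal.span {Q} := by
  constructor
  · rintro ⟨hq, h⟩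
    have hb : q ≠ ⊥ := q.ne_bot_of_height_eq_one h
    obtain ⟨x, hx, hp⟩ := Ideal.IsPrime.exists_mem_prime_of_ne_bot hq hb
    exact ⟨x, hp, q.eq_span_singleton_of_height_eq_one h hx hp⟩
  · rintro ⟨Q, hQ, rfl⟩
    have hpr : (Ideal.span {Q}).IsPrime := (Ideal.span_singleton_prime hQ.ne_zero).2 hQ
    refine ⟨hpr, le_antisymm ?_ ?_⟩
    · exact Ideal.height_le_one_of_isPrincipal_of_mem_minimalPrimes (Ideal.span {Q}) _
        (by rw [Ideal.minimalPrimes_eq_subsingleton_self]; rfl)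
    · rw [Order.one_le_iff_ne_zero, Ne, Ideal.height_eq_zero_iff_eq_bot]
      exact fun h => hQ.ne_zero (Ideal.span_singleton_eq_bot.1 h)

variable {f : Fin n → MvPolynomial (Fin n) ℂ}

theorem algebraMap_subalg (x : subalg f) : algebraMap (subalg f) (MvPolynomial (Fin n) ℂ) x = x := rfl

theorem under_span_eq {Q : MvPolynomial (Fin n) ℂ} {P : subalg f}
    (h : ∀ x : subalg f, Q ∣ (x : MvPolynomial (Fin n) ℂ) ↔ P ∣ x) :
    (Ideal.span {Q}).under (subalg f) = Ideal.span {P} := by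
  ext x
  rw [Ideal.mem_span_singleton, ← h, ← Ideal.mem_span_singleton]
  rfl

theorem isUnit_of_isUnit_coe {P : subalg f} (h : IsUnit (P : MvPolynomial (Fin n) ℂ)) : IsUnit P := by
  rw [MvPolynomial.isUnit_iff_eq_C_of_isReduced] at h
  obtain ⟨c, hc, h⟩ := h
  have : P = algebraMap ℂ (subalg f) c := Subtype.ext h
  rw [this]
  exact hc.map _

/-- Identifies the ideal-theoretic index with the multiplicity of `Q` in `P`; this multiplicity is
finite, so `ramIdx` is not a default value. -/
theorem pow_dvd_iff_le_ramIdx {Q : MvPolynomial (Fin n) ℂ} (hQ : Prime Q) {P : subalg f}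
    (hP : Prime P) (h : ∀ x : subalg f, Q ∣ (x : MvPolynomial (Fin n) ℂ) ↔ P ∣ x) (k : ℕ) :
    Q ^ k ∣ (P : MvPolynomial (Fin n) ℂ) ↔ k ≤ ramIdx f (Ideal.span {Q}) := by
  have hle : ∀ k, Ideal.map (algebraMap (subalg f) (MvPolynomial (Fin n) ℂ))
      ((Ideal.span {Q}).under (subalg f)) ≤ Ideal.span {Q} ^ k ↔
      Q ^ k ∣ (P : MvPolynomial (Fin n) ℂ) := by
    intro k
    rw [under_span_eq h, Ideal.map_span, Set.image_singleton, Ideal.span_singleton_pow,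
      Ideal.span_singleton_le_span_singleton, algebraMap_subalg]
  have hP0 : (P : MvPolynomial (Fin n) ℂ) ≠ 0 := by simpa using hP.ne_zero
  obtain ⟨m, hm⟩ : ∃ m : ℕ, (m : ℕ∞) = emultiplicity Q (P : MvPolynomial (Fin n) ℂ) :=
    ENat.ne_top_iff_exists.1 (finiteMultiplicity_iff_emultiplicity_ne_top.1
      (FiniteMultiplicity.of_prime_left hQ hP0))
  have hram : ramIdx f (Ideal.span {Q}) = m := by
    refine Ideal.ramificationIdx'_spec ((hle m).2 ?_) (fun h => ?_)
    · rw [pow_dvd_iff_le_emultiplicity, ← hm]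
    · rw [hle, pow_dvd_iff_le_emultiplicity, ← hm] at h
      exact absurd (Nat.cast_le.1 h) (by omega)
  rw [hram, pow_dvd_iff_le_emultiplicity, ← hm, Nat.cast_le]

theorem exists_prime_dvd_coe {P : subalg f} (hP : Prime P) :
    ∃ Q : MvPolynomial (Fin n) ℂ, Prime Q ∧ Q ∣ (P : MvPolynomial (Fin n) ℂ) := by
  obtain ⟨Q, hQ, h⟩ := WfDvdMonoid.exists_irreducible_factor
    (fun h => hP.not_isUnit (isUnit_of_isUnit_coe h)) (show (P : MvPolynomial (Fin n) ℂ) ≠ 0 by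
      simpa using hP.ne_zero)
  exact ⟨Q, hQ.prime, h⟩

section Finite

variable [Module.Finite (subalg f) (MvPolynomial (Fin n) ℂ)]

variable (f) in
/-- `A` is a polynomial ring in the `fᵢ`. -/
def polyEquiv : MvPolynomial (Fin n) ℂ ≃ₐ[ℂ] subalg f := (algebraicIndependent f).aevalEquiv

theorem coe_polyEquiv (F : MvPolynomial (Fin n) ℂ) :
    (polyEquiv f F : MvPolynomial (Fin n) ℂ) = aeval f F := rfl

instance : UniqueFactorizationMonoid (subalg f) :=
  (polyEquiv f).toMulEquiv.uniqueFactorizationMonoid inferInstance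

instance : IsNoetherianRing (subalg f) :=
  isNoetherianRing_of_ringEquiv _ (polyEquiv f).toRingEquiv

/-- A prime element of `B` lies over a prime element of `A`. -/
theorem exists_prime_under {Q : MvPolynomial (Fin n) ℂ} (hQ : Prime Q) :
    ∃ P : subalg f, Prime P ∧ ∀ x : subalg f, Q ∣ (x : MvPolynomial (Fin n) ℂ) ↔ P ∣ x := by
  have hpr : (Ideal.span {Q}).IsPrime := (Ideal.span_singleton_prime hQ.ne_zero).2 hQ
  have hb : (Ideal.span {Q}).under (subalg f) ≠ ⊥ := by
    intro h
    exact hQ.ne_zero (Ideal.span_singleton_eq_bot.1 (Ideal.eq_bot_of_comap_eq_bot h))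
  obtain ⟨P, hPq, hP⟩ := Ideal.IsPrime.exists_mem_prime_of_ne_bot inferInstance hb
  have hPp : (Ideal.span {P}).IsPrime := (Ideal.span_singleton_prime hP.ne_zero).2 hP
  have hle : Ideal.span {P} ≤ (Ideal.span {Q}).under (subalg f) := by
    rwa [Ideal.span_singleton_le_iff_mem]
  -- Going-down, `A` being normal: if `(P)` were strictly smaller, a prime strictly inside `(Q)`
  -- would lie over it. Only `⊥` is available, and it lies over `⊥`.
  have heq : Ideal.span {P} = (Ideal.span {Q}).under (subalg f) := by
    by_contra hne
    obtain ⟨q', hlt, hq', hover⟩ := Ideal.exists_ideal_lt_liesOver_of_lt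
      (p := Ideal.span {P}) (q := (Ideal.span {Q}).under (subalg f)) (Ideal.span {Q})
      (lt_of_le_of_ne hle hne)
    have hq'b : q' = ⊥ := by
      by_contra hb'
      obtain ⟨y, hy, hyp⟩ := Ideal.IsPrime.exists_mem_prime_of_ne_bot hq' hb'
      have h1 : Q ∣ y := Ideal.mem_span_singleton.1 (hlt.le hy)
      have h2 : y ∣ Q := ((hQ.dvd_prime_iff_associated hyp).1 h1).symm.dvd
      exact hlt.not_ge ((Ideal.span_singleton_le_iff_mem _).2 (Ideal.mem_of_dvd _ h2 hy))
    have h3 := hover.over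
    rw [hq'b] at h3
    apply hP.ne_zero
    have : P ∈ Ideal.span {P} := Ideal.mem_span_singleton_self P
    rw [h3] at this
    have h4 : (P : MvPolynomial (Fin n) ℂ) = 0 := this
    exact_mod_cast h4
  refine ⟨P, hP, fun x => ?_⟩
  rw [← Ideal.mem_span_singleton, ← Ideal.mem_span_singleton, heq]
  rfl

theorem one_le_ramIdx {Q : MvPolynomial (Fin n) ℂ} (hQ : Prime Q) :
    1 ≤ ramIdx f (Ideal.span {Q}) := by
  obtain ⟨P, hP, h⟩ := exists_prime_under (f := f) hQ
  rw [← pow_dvd_iff_le_ramIdx hQ hP h, pow_one, h]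

/-- A prime of `B` dividing a prime of `A` lies over it. -/
theorem dvd_coe_iff {Q : MvPolynomial (Fin n) ℂ} (hQ : Prime Q) {P : subalg f}
    (hP : Prime P) (hQP : Q ∣ (P : MvPolynomial (Fin n) ℂ)) (x : subalg f) :
    Q ∣ (x : MvPolynomial (Fin n) ℂ) ↔ P ∣ x := by
  obtain ⟨P', hP', h⟩ := exists_prime_under (f := f) hQ
  rw [h, ((hP'.dvd_prime_iff_associated hP).1 ((h P).1 hQP)).dvd_iff_dvd_left]

/-- Divisibility in `B` of elements of `A` implies divisibility in `A`. -/
theorem dvd_of_coe_dvd_coe {x y : subalg f}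
    (h : (x : MvPolynomial (Fin n) ℂ) ∣ (y : MvPolynomial (Fin n) ℂ)) : x ∣ y := by
  induction x using UniqueFactorizationMonoid.induction_on_prime generalizing y with
  | h₁ =>
    rw [ZeroMemClass.coe_zero, zero_dvd_iff] at h
    rw [zero_dvd_iff]
    exact_mod_cast h
  | h₂ x hx => exact hx.dvd
  | h₃ x P _ hP ih =>
    obtain ⟨Q, hQ, hQP⟩ := exists_prime_dvd_coe hP
    rw [MulMemClass.coe_mul] at h
    obtain ⟨y, rfl⟩ := (dvd_coe_iff hQ hP hQP y).1 (hQP.trans ((dvd_mul_right _ _).trans h))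
    refine mul_dvd_mul_left _ (ih ?_)
    rw [MulMemClass.coe_mul] at h
    exact (mul_dvd_mul_iff_left (by simpa using hP.ne_zero)).1 h

end Finite

/-! ### The order of the Jacobian along a prime of height one -/

theorem exists_not_dvd_pderiv {F : MvPolynomial (Fin n) ℂ} (hF : ∀ c, F ≠ C c) :
    ∃ i, ¬ F ∣ pderiv i F := by
  obtain ⟨i, hi⟩ := exists_pderiv_ne_zero hF
  refine ⟨i, fun ⟨G, hG⟩ => ?_⟩
  have h0 : F * G ≠ 0 := hG ▸ hi
  have h1 := totalDegree_pderiv_lt hi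
  rw [hG, totalDegree_mul_of_isDomain (left_ne_zero_of_mul h0) (right_ne_zero_of_mul h0)] at h1
  omega

section Finite

variable [Module.Finite (subalg f) (MvPolynomial (Fin n) ℂ)]

/-- Along a prime `Q` of `B` over a prime `P` of `A`, the Jacobian vanishes to exactly one order
less than `P`. -/
theorem jac_order {Q : MvPolynomial (Fin n) ℂ} (hQ : Prime Q) {P : subalg f} (hP : Prime P)
    (h : ∀ x : subalg f, Q ∣ (x : MvPolynomial (Fin n) ℂ) ↔ P ∣ x) {e : ℕ}
    {R : MvPolynomial (Fin n) ℂ} (hR : ¬ Q ∣ R)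
    (hPe : (P : MvPolynomial (Fin n) ℂ) = Q ^ (e + 1) * R) :
    Q ^ e ∣ jac f ∧ ¬ Q ^ (e + 1) ∣ jac f := by
  classical
  obtain ⟨F, rfl⟩ := (polyEquiv f).surjective P
  obtain ⟨i, hi⟩ : ∃ i, ¬ F ∣ pderiv i F := by
    refine exists_not_dvd_pderiv fun c hc => ?_
    by_cases hc0 : c = 0
    · exact hP.ne_zero (by rw [hc, hc0, C_0, map_zero])
    · refine hP.not_isUnit ?_
      rw [hc]
      exact ((isUnit_iff_ne_zero.2 hc0).map C).map (polyEquiv f)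
  have hgi : ¬ Q ∣ aeval f (pderiv i F) := by
    rw [← coe_polyEquiv, h]
    exact fun hd => hi ((map_dvd_iff (polyEquiv f)).1 hd)
  rw [coe_polyEquiv] at hPe
  -- The gradient of `P = Q ^ (e + 1) * R` is `Q ^ e • u`.
  set u : Fin n → MvPolynomial (Fin n) ℂ :=
    fun j => ((e : MvPolynomial (Fin n) ℂ) + 1) * R * pderiv j Q + Q * pderiv j R with hu
  have hrow : ∑ k, aeval f (pderiv k F) • jacMatrix f k = Q ^ e • u := by
    funext j
    have h1 := pderiv_aeval f F j
    rw [hPe, pderiv_mul, pderiv_pow] at h1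
    simp only [Finset.sum_apply, Pi.smul_apply, smul_eq_mul, hu, jacMatrix, Matrix.of_apply]
    rw [← h1]
    simp only [Nat.add_sub_cancel, Nat.cast_add, Nat.cast_one]
    ring
  -- Replacing row `i` by the gradient of `F(f)` multiplies the determinant by the coefficient of
  -- row `i`, which is prime to `Q`.
  have hdet : aeval f (pderiv i F) * jac f = Q ^ e * ((jacMatrix f).updateRow i u).det := by
    have h1 := Matrix.det_updateRow_sum (jacMatrix f) i fun k => aeval f (pderiv k F)
    rw [hrow, Matrix.det_updateRow_smul] at h1
    exact h1.symm
  refine ⟨hQ.pow_dvd_of_dvd_mul_left _ hgi ⟨_, hdet⟩, fun hd => ?_⟩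
  have hQdet : Q ∣ ((jacMatrix f).updateRow i u).det := by
    have h1 : Q ^ e * Q ∣ Q ^ e * ((jacMatrix f).updateRow i u).det := by
      rw [← hdet, ← pow_succ]
      exact hd.mul_left _
    exact (mul_dvd_mul_iff_left (pow_ne_zero _ hQ.ne_zero)).1 h1
  -- If `Q` divided the remaining determinant, that matrix would have a kernel vector `w` over the
  -- function field `L` of `Q = 0`; the derivation along `w` is shown to vanish.
  have hpr : (Ideal.span {Q}).IsPrime := (Ideal.span_singleton_prime hQ.ne_zero).2 hQ
  let L := FractionRing (MvPolynomial (Fin n) ℂ ⧸ Ideal.span {Q})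
  let φ : MvPolynomial (Fin n) ℂ →+* L := (algebraMap (MvPolynomial (Fin n) ℂ ⧸ Ideal.span {Q}) L).comp (Ideal.Quotient.mk _)
  have hφ : ∀ g, φ g = 0 ↔ Q ∣ g := by
    intro g
    rw [← Ideal.mem_span_singleton, ← Ideal.Quotient.eq_zero_iff_mem]
    exact map_eq_zero_iff (algebraMap (MvPolynomial (Fin n) ℂ ⧸ Ideal.span {Q}) L)
      (IsFractionRing.injective _ L)
  have : CharZero L := charZero_of_injective_ringHom (φ.comp C).injective
  have hdet0 : (φ.mapMatrix ((jacMatrix f).updateRow i u)).det = 0 := by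
    rw [← RingHom.map_det, hφ]
    exact hQdet
  obtain ⟨w, hw, hw0⟩ := Matrix.exists_mulVec_eq_zero_iff.2 hdet0
  have hfk : ∀ k, k ≠ i → dir φ w (f k) = 0 := by
    intro k hk
    have := congrFun hw0 k
    simpa [Matrix.mulVec, dotProduct, Matrix.updateRow_ne hk, jacMatrix, dir] using this
  -- Modulo `Q`, row `i` is `(e + 1) * R` times the gradient of `Q`, and this factor is nonzero in
  -- `L`.
  have hQw : dir φ w Q = 0 := by
    have h1 := congrFun hw0 i
    have h2 : φ Q = 0 := (hφ _).2 dvd_rfl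
    have h3 : ((e : L) + 1) * φ R * dir φ w Q = 0 := by
      rw [dir, Finset.mul_sum]
      simpa [Matrix.mulVec, dotProduct, hu, h2, mul_assoc] using h1
    refine (mul_eq_zero.1 h3).resolve_left (mul_ne_zero (Nat.cast_add_one_ne_zero e) ?_)
    rwa [Ne, hφ]
  have hker : ∀ g, φ g = 0 → dir φ w g = 0 := by
    intro g hg
    obtain ⟨g', rfl⟩ := (hφ g).1 hg
    rw [dir_mul, hQw, (hφ Q).2 dvd_rfl, mul_zero, zero_mul, add_zero]
  -- `F(f) = P` is a multiple of `Q`, hence killed; in the chain rule only the term of `f i`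
  -- survives.
  have hfi : dir φ w (f i) = 0 := by
    have h1 := dir_aeval_mv φ w f F
    rw [← coe_polyEquiv F, hker _ ((hφ _).2 ((h _).2 dvd_rfl)), Finset.sum_eq_single i] at h1
    · exact (mul_eq_zero.1 h1.symm).resolve_left (by rwa [hφ])
    · intro k _ hk
      rw [hfk k hk, mul_zero]
    · simp
  refine hw (eq_zero_of_dir_eq_zero (A := subalg f)
    (fun a ha => dir_eq_zero_of_mem_adjoin ?_ ha) hker)
  rintro _ ⟨k, rfl⟩
  by_cases hk : k = i
  · rw [hk, hfi]
  · exact hfk k hk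

theorem pow_dvd_jac_iff {Q : MvPolynomial (Fin n) ℂ} (hQ : Prime Q) (k : ℕ) :
    Q ^ k ∣ jac f ↔ k < ramIdx f (Ideal.span {Q}) := by
  obtain ⟨P, hP, h⟩ := exists_prime_under (f := f) hQ
  have hle := pow_dvd_iff_le_ramIdx hQ hP h
  obtain ⟨e, he⟩ : ∃ e, ramIdx f (Ideal.span {Q}) = e + 1 :=
    Nat.exists_eq_succ_of_ne_zero (Nat.one_le_iff_ne_zero.1 (one_le_ramIdx hQ))
  obtain ⟨R, hR⟩ := (hle (e + 1)).2 he.ge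
  have hQR : ¬ Q ∣ R := by
    rintro ⟨R', rfl⟩
    have := (hle (e + 2)).1 ⟨R', by rw [hR]; ring⟩
    omega
  obtain ⟨h1, h2⟩ := jac_order hQ hP h hQR hR
  rw [he, Nat.lt_succ_iff]
  refine ⟨fun hk => ?_, fun hk => (pow_dvd_pow Q hk).trans h1⟩
  by_contra hlt
  exact h2 ((pow_dvd_pow Q (by omega)).trans hk)

theorem dvd_jac_iff {Q : MvPolynomial (Fin n) ℂ} (hQ : Prime Q) :
    Q ∣ jac f ↔ 1 < ramIdx f (Ideal.span {Q}) := by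
  rw [← pow_dvd_jac_iff hQ, pow_one]

variable (f) in
theorem finite_Spec1Ram : (Spec1Ram f).Finite := by
  classical
  refine ((UniqueFactorizationMonoid.factors (jac f)).toFinset.image
    fun Q => Ideal.span {Q}).finite_toSet.subset ?_
  rintro q ⟨hq, hram⟩
  obtain ⟨Q, hQ, rfl⟩ := mem_Spec1_iff.1 hq
  obtain ⟨Q', hQ', hass⟩ := UniqueFactorizationMonoid.exists_mem_factors_of_dvd (jac_ne_zero f)
    hQ.irreducible ((dvd_jac_iff hQ).2 hram)
  simp only [Finset.coe_image, Set.mem_image, Finset.mem_coe, Multiset.mem_toFinset]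
  exact ⟨Q', hQ', (Ideal.span_singleton_eq_span_singleton.2 hass).symm⟩

end Finite

/-! ### The product of the ramified primes -/

theorem dvd_of_forall_prime_pow_dvd {R : Type*} [CommRing R] [IsDomain R]
    [UniqueFactorizationMonoid R] {x y : R} (hx : x ≠ 0)
    (h : ∀ Q, Prime Q → ∀ k, Q ^ k ∣ x → Q ^ k ∣ y) : x ∣ y := by
  induction x using UniqueFactorizationMonoid.induction_on_prime generalizing y with
  | h₁ => exact absurd rfl hx
  | h₂ x hu => exact hu.dvd
  | h₃ x Q _ hQ ih =>
    obtain ⟨y, rfl⟩ : Q ∣ y := by simpa using h Q hQ 1 (by simp)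
    refine mul_dvd_mul_left _ (ih (right_ne_zero_of_mul hx) fun R hR k hk => ?_)
    by_cases hRQ : R ∣ Q
    · have hass := (hR.dvd_prime_iff_associated hQ).1 hRQ
      have h1 := h R hR (k + 1) (by rw [pow_succ']; exact mul_dvd_mul hRQ hk)
      rw [pow_succ'] at h1
      exact (mul_dvd_mul_iff_left hR.ne_zero).1
        (h1.trans (mul_dvd_mul_right hass.symm.dvd y))
    · exact hR.pow_dvd_of_dvd_mul_left k hRQ (h R hR k (hk.mul_left Q))

theorem prime_rep (q : Spec1Ram f) : Prime (rep f q) := by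
  have h0 : rep f q ≠ 0 := by
    intro h
    have := span_rep f q
    rw [h, Ideal.span_singleton_eq_bot.2 rfl] at this
    have h1 := q.2.1.1
    exact q.1.ne_bot_of_height_eq_one q.2.1.2 this.symm
  rw [← Ideal.span_singleton_prime h0, span_rep]
  exact q.2.1.1

theorem one_lt_ramIdx_rep (q : Spec1Ram f) : 1 < ramIdx f (Ideal.span {rep f q}) := by
  rw [span_rep]
  exact q.2.2

theorem exists_associated_rep {Q : MvPolynomial (Fin n) ℂ} (hQ : Prime Q)
    (h : 1 < ramIdx f (Ideal.span {Q})) : ∃ q : Spec1Ram f, Associated Q (rep f q) ∧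
      q.1 = Ideal.span {Q} :=
  have hmem : Ideal.span {Q} ∈ Spec1Ram f := ⟨mem_Spec1_iff.2 ⟨Q, hQ, rfl⟩, h⟩
  ⟨⟨_, hmem⟩, Ideal.span_singleton_eq_span_singleton.1 (span_rep f ⟨_, hmem⟩).symm, rfl⟩

theorem isRelPrime_rep {q q' : Spec1Ram f} (h : q ≠ q') : IsRelPrime (rep f q) (rep f q') := by
  rw [(prime_rep q).irreducible.isRelPrime_iff_not_dvd,
    (prime_rep q).dvd_prime_iff_associated (prime_rep q'),
    ← Ideal.span_singleton_eq_span_singleton, span_rep, span_rep]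
  exact fun h' => h (Subtype.ext h')

section Finite

variable [Module.Finite (subalg f) (MvPolynomial (Fin n) ℂ)]

instance : Finite (Spec1Ram f) := (finite_Spec1Ram f).to_subtype

/-- The element `x` is divisible by the prime `P` of `A` below `Q`, and `P` carries the full power
of `Q`. -/
theorem pow_ramIdx_dvd_coe {Q : MvPolynomial (Fin n) ℂ} (hQ : Prime Q) {x : subalg f}
    (h : Q ∣ (x : MvPolynomial (Fin n) ℂ)) :
    Q ^ ramIdx f (Ideal.span {Q}) ∣ (x : MvPolynomial (Fin n) ℂ) := by
  obtain ⟨P, hP, hiff⟩ := exists_prime_under (f := f) hQ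
  obtain ⟨y, rfl⟩ := (hiff x).1 h
  rw [MulMemClass.coe_mul]
  exact ((pow_dvd_iff_le_ramIdx hQ hP hiff _).2 le_rfl).mul_right _

theorem rep_dvd_ramProd (q : Spec1Ram f) : rep f q ∣ ramProd f := by
  have := Fintype.ofFinite (Spec1Ram f)
  rw [ramProd, finprod_eq_prod_of_fintype]
  exact Finset.dvd_prod_of_mem _ (Finset.mem_univ q)

theorem rep_pow_dvd_ramPowProd (q : Spec1Ram f) : rep f q ^ ramIdx f q.1 ∣ ramPowProd f := by
  have := Fintype.ofFinite (Spec1Ram f)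
  rw [ramPowProd, finprod_eq_prod_of_fintype]
  exact Finset.dvd_prod_of_mem (fun q : Spec1Ram f => rep f q ^ ramIdx f q.1) (Finset.mem_univ q)

theorem ramProd_dvd_ramPowProd : ramProd f ∣ ramPowProd f := by
  have := Fintype.ofFinite (Spec1Ram f)
  rw [ramProd, ramPowProd, finprod_eq_prod_of_fintype, finprod_eq_prod_of_fintype]
  exact Finset.prod_dvd_prod_of_dvd _ _ fun q _ =>
    dvd_pow_self _ (Nat.ne_zero_of_lt q.2.2)

theorem ramPowProd_dvd_iff {x : MvPolynomial (Fin n) ℂ} :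
    ramPowProd f ∣ x ↔ ∀ q : Spec1Ram f, rep f q ^ ramIdx f q.1 ∣ x := by
  refine ⟨fun h q => (rep_pow_dvd_ramPowProd q).trans h, fun h => ?_⟩
  have := Fintype.ofFinite (Spec1Ram f)
  rw [ramPowProd, finprod_eq_prod_of_fintype]
  exact Fintype.prod_dvd_of_isRelPrime (fun q q' hq => (isRelPrime_rep hq).pow) h

theorem dvd_ramPowProd_iff {Q : MvPolynomial (Fin n) ℂ} (hQ : Prime Q) :
    Q ∣ ramPowProd f ↔ 1 < ramIdx f (Ideal.span {Q}) := by
  constructor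
  · intro h
    have := Fintype.ofFinite (Spec1Ram f)
    rw [ramPowProd, finprod_eq_prod_of_fintype] at h
    obtain ⟨q, -, hq⟩ := hQ.exists_mem_finset_dvd h
    have h1 := (hQ.dvd_prime_iff_associated (prime_rep q)).1 (hQ.dvd_of_dvd_pow hq)
    rw [Ideal.span_singleton_eq_span_singleton.2 h1]
    exact one_lt_ramIdx_rep q
  · intro h
    obtain ⟨q, hq, hqQ⟩ := exists_associated_rep hQ h
    exact hq.dvd.trans ((dvd_pow_self _ (Nat.ne_zero_of_lt q.2.2)).trans
      (rep_pow_dvd_ramPowProd q))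

theorem pow_ramIdx_dvd_ramPowProd {Q : MvPolynomial (Fin n) ℂ} (hQ : Prime Q)
    (h : 1 < ramIdx f (Ideal.span {Q})) : Q ^ ramIdx f (Ideal.span {Q}) ∣ ramPowProd f := by
  obtain ⟨q, hq, hqQ⟩ := exists_associated_rep hQ h
  rw [← hqQ]
  exact (pow_dvd_pow_of_dvd hq.dvd _).trans (rep_pow_dvd_ramPowProd q)

theorem jac_dvd_ramPowProd : jac f ∣ ramPowProd f := by
  refine dvd_of_forall_prime_pow_dvd (jac_ne_zero f) fun Q hQ k hk => ?_
  rw [pow_dvd_jac_iff hQ] at hk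
  rcases Nat.eq_zero_or_pos k with rfl | hk0
  · simp
  · exact (pow_dvd_pow Q hk.le).trans (pow_ramIdx_dvd_ramPowProd hQ (by omega))

/-- Serves both `g = J` and `g = ∏ Q`: only the prime factors of `g` matter. -/
theorem contractsTo_of_mem (hE : ramPowProd f ∈ subalg f) {g : MvPolynomial (Fin n) ℂ}
    (hg : ∀ q : Spec1Ram f, rep f q ∣ g) (hgE : g ∣ ramPowProd f) :
    ContractsTo f g (ramPowProd f) := by
  ext x
  simp only [Set.mem_inter_iff, SetLike.mem_coe, Ideal.mem_span_singleton,
    Submodule.mem_span_singleton]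
  constructor
  · rintro ⟨hgx, hx⟩
    have h1 : ramPowProd f ∣ x := ramPowProd_dvd_iff.2 fun q => by
      have := pow_ramIdx_dvd_coe (prime_rep q) (x := ⟨x, hx⟩) ((hg q).trans hgx)
      rwa [span_rep] at this
    obtain ⟨y, hy⟩ := dvd_of_coe_dvd_coe (x := ⟨_, hE⟩) (y := ⟨x, hx⟩) h1
    refine ⟨y, ?_⟩
    rw [Algebra.smul_def, mul_comm]
    exact (congrArg Subtype.val hy).symm
  · rintro ⟨y, rfl⟩
    rw [Algebra.smul_def]
    exact ⟨hgE.mul_left _, mul_mem y.2 hE⟩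

omit [Module.Finite (subalg f) (MvPolynomial (Fin n) ℂ)] in
theorem mem_of_contractsTo {g h : MvPolynomial (Fin n) ℂ} (H : ContractsTo f g h) :
    h ∈ subalg f :=
  (H.ge (Submodule.mem_span_singleton_self h)).2

theorem wellRamified_iff : WellRamified f ↔ ramPowProd f ∈ subalg f :=
  ⟨mem_of_contractsTo, fun h => contractsTo_of_mem h
    (fun q => (dvd_jac_iff (prime_rep q)).2 (one_lt_ramIdx_rep q)) jac_dvd_ramPowProd⟩

theorem contractsTo_ramProd_iff :
    ContractsTo f (ramProd f) (ramPowProd f) ↔ ramPowProd f ∈ subalg f :=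
  ⟨mem_of_contractsTo, fun h => contractsTo_of_mem h rep_dvd_ramProd ramProd_dvd_ramPowProd⟩

/-! ### Ramification in the fibres over the primes of `A` -/

variable (f) in
/-- If one prime factor of a prime element of `A` is ramified, then all of them are. -/
def UniformlyRamified : Prop :=
  ∀ P : subalg f, Prime P → ∀ Q₀ Q : MvPolynomial (Fin n) ℂ, Prime Q₀ → Prime Q →
    Q₀ ∣ (P : MvPolynomial (Fin n) ℂ) → Q ∣ (P : MvPolynomial (Fin n) ℂ) →
    1 < ramIdx f (Ideal.span {Q₀}) → 1 < ramIdx f (Ideal.span {Q})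

theorem uniformlyRamified_iff : UniformlyRamified f ↔
    ∀ p ∈ Spec1 (subalg f),
      (∃ q₀ ∈ Spec1 (MvPolynomial (Fin n) ℂ), q₀.under (subalg f) = p ∧ 1 < ramIdx f q₀) →
      ∀ q ∈ Spec1 (MvPolynomial (Fin n) ℂ), q.under (subalg f) = p → 1 < ramIdx f q := by
  constructor
  · rintro h p hp ⟨q₀, hq₀, hu₀, hram⟩ q hq hu
    obtain ⟨P, hP, rfl⟩ := mem_Spec1_iff.1 hp
    obtain ⟨Q₀, hQ₀, rfl⟩ := mem_Spec1_iff.1 hq₀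
    obtain ⟨Q, hQ, rfl⟩ := mem_Spec1_iff.1 hq
    refine h P hP Q₀ Q hQ₀ hQ (Ideal.mem_span_singleton.1 (hu₀.ge ?_))
      (Ideal.mem_span_singleton.1 (hu.ge ?_)) hram <;>
    exact Ideal.mem_span_singleton_self P
  · intro h P hP Q₀ Q hQ₀ hQ h₀ hd hram
    exact h _ (mem_Spec1_iff.2 ⟨P, hP, rfl⟩)
      ⟨_, mem_Spec1_iff.2 ⟨Q₀, hQ₀, rfl⟩, under_span_eq (dvd_coe_iff hQ₀ hP h₀), hram⟩
      _ (mem_Spec1_iff.2 ⟨Q, hQ, rfl⟩) (under_span_eq (dvd_coe_iff hQ hP hd))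

omit [Module.Finite (subalg f) (MvPolynomial (Fin n) ℂ)] in
theorem mem_subalg_of_associated {x y : MvPolynomial (Fin n) ℂ} (h : Associated x y)
    (hx : x ∈ subalg f) : y ∈ subalg f := by
  obtain ⟨u, rfl⟩ := h
  obtain ⟨c, -, hc⟩ := (MvPolynomial.isUnit_iff_eq_C_of_isReduced).1 u.isUnit
  rw [hc]
  exact mul_mem hx ((subalg f).algebraMap_mem c)

theorem ramPowProd_mem_iff : ramPowProd f ∈ subalg f ↔ UniformlyRamified f := by
  classical
  constructor
  · intro hE P hP Q₀ Q hQ₀ hQ h₀ hd hram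
    have h1 := (dvd_coe_iff hQ₀ hP h₀ ⟨_, hE⟩).1 ((dvd_ramPowProd_iff hQ₀).2 hram)
    exact (dvd_ramPowProd_iff hQ).1 ((dvd_coe_iff hQ hP hd ⟨_, hE⟩).2 h1)
  · intro h
    have := Fintype.ofFinite (Spec1Ram f)
    have hgen : ∀ q : Spec1Ram f, ∃ P : subalg f, Prime P ∧
        q.1.under (subalg f) = Ideal.span {P} := by
      intro q
      obtain ⟨P, hP, hiff⟩ := exists_prime_under (f := f) (prime_rep q)
      exact ⟨P, hP, by rw [← under_span_eq hiff, span_rep]⟩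
    -- As a set of contractions, `S` counts once each prime of `A` that lies below several ramified
    -- primes.
    let S : Finset (Ideal (subalg f)) := Finset.univ.image fun q : Spec1Ram f => q.1.under (subalg f)
    have hS : ∀ p ∈ S, ∃ P : subalg f, Prime P ∧ p = Ideal.span {P} := by
      intro p hp
      obtain ⟨q, -, rfl⟩ := Finset.mem_image.1 hp
      exact hgen q
    choose! P hP hspan using hS
    refine mem_subalg_of_associated (x := ((∏ p ∈ S, P p : subalg f) : MvPolynomial (Fin n) ℂ)) ?_
      (SetLike.coe_mem _)
    have hmem : ∀ q : Spec1Ram f, q.1.under (subalg f) ∈ S := fun q =>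
      Finset.mem_image_of_mem _ (Finset.mem_univ q)
    have hdvd : ∀ q : Spec1Ram f,
        rep f q ∣ (P (q.1.under (subalg f)) : MvPolynomial (Fin n) ℂ) := by
      intro q
      rw [← Ideal.mem_span_singleton, span_rep]
      have h1 := Ideal.mem_span_singleton_self (P (q.1.under (subalg f)))
      rw [← hspan _ (hmem q)] at h1
      exact h1
    refine associated_of_dvd_dvd ?_ (ramPowProd_dvd_iff.2 fun q => ?_)
    · rw [SubmonoidClass.coe_finsetProd]
      -- Distinct primes of `A` stay coprime in `B`, because a prime of `B` lies over only one of
      -- them.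
      refine Finset.prod_dvd_of_isRelPrime (fun p hp p' hp' hne => ?_) fun p hp => ?_
      · rw [Function.onFun]
        refine (WfDvdMonoid.isRelPrime_of_no_irreducible_factors ?_ ?_)
        · simp [(hP p hp).ne_zero]
        · intro Q hQ h1 h2
          have h3 := ((dvd_coe_iff hQ.prime (hP p hp) h1) _).1 h2
          apply hne
          rw [hspan p hp, hspan p' hp', Ideal.span_singleton_eq_span_singleton]
          exact ((hP p hp).dvd_prime_iff_associated (hP p' hp')).1 h3
      · refine dvd_of_forall_prime_pow_dvd (by simpa using (hP p hp).ne_zero) fun Q hQ k hk => ?_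
        rcases Nat.eq_zero_or_pos k with rfl | hk0
        · simp
        have hQP := (dvd_pow_self Q hk0.ne').trans hk
        have hle := (pow_dvd_iff_le_ramIdx hQ (hP p hp) (dvd_coe_iff hQ (hP p hp) hQP) k).1 hk
        obtain ⟨q, -, rfl⟩ := Finset.mem_image.1 hp
        exact (pow_dvd_pow Q hle).trans (pow_ramIdx_dvd_ramPowProd hQ
          (h _ (hP _ hp) _ Q (prime_rep q) hQ (hdvd q) hQP (one_lt_ramIdx_rep q)))
    · have h1 := pow_ramIdx_dvd_coe (prime_rep q) (hdvd q)
      rw [span_rep] at h1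
      rw [SubmonoidClass.coe_finsetProd]
      exact h1.trans (Finset.dvd_prod_of_mem (fun p => (P p : MvPolynomial (Fin n) ℂ)) (hmem q))

theorem uniformlyRamified_iff_squarefree_or : UniformlyRamified f ↔
    ∀ P : subalg f, Irreducible P → Squarefree (P : MvPolynomial (Fin n) ℂ) ∨
      CompletelyNonReduced (P : MvPolynomial (Fin n) ℂ) := by
  have hsq : ∀ {P : subalg f} {Q : MvPolynomial (Fin n) ℂ}, Prime P → Prime Q →
      Q ∣ (P : MvPolynomial (Fin n) ℂ) →
      (Q ^ 2 ∣ (P : MvPolynomial (Fin n) ℂ) ↔ 1 < ramIdx f (Ideal.span {Q})) :=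
    fun hP hQ h => pow_dvd_iff_le_ramIdx hQ hP (dvd_coe_iff hQ hP h) 2
  constructor
  · intro h P hP
    by_cases hs : ∃ Q, Prime Q ∧ Q ^ 2 ∣ (P : MvPolynomial (Fin n) ℂ)
    · obtain ⟨Q₀, hQ₀, hd⟩ := hs
      have h0 := (dvd_pow_self Q₀ two_ne_zero).trans hd
      exact Or.inr fun Q hQ hQP => (hsq hP.prime hQ.prime hQP).2
        (h P hP.prime Q₀ Q hQ₀ hQ.prime h0 hQP ((hsq hP.prime hQ₀ h0).1 hd))
    · refine Or.inl ((squarefree_iff_irreducible_sq_not_dvd_of_ne_zero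
        (by simpa using hP.ne_zero)).2 fun Q hQ hd => hs ⟨Q, hQ.prime, ?_⟩)
      rwa [sq]
  · intro h P hP Q₀ Q hQ₀ hQ h₀ hd hram
    rw [← hsq hP hQ hd]
    rcases h P hP.irreducible with h1 | h1
    · refine absurd (h1 Q₀ ?_) hQ₀.not_isUnit
      rw [← sq, hsq hP hQ₀ h₀]
      exact hram
    · exact h1 Q hQ.irreducible hd

end Finite

/-! ### Points -/

theorem eval_aeval_polyMap (v : Fin n → ℂ) (F : MvPolynomial (Fin n) ℂ) :
    eval v (aeval f F) = eval (polyMap f v) F := by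
  induction F using MvPolynomial.induction_on with
  | C c => simp
  | add p q hp hq => simp only [map_add, hp, hq]
  | mul_X p k hp => simp only [map_mul, hp, aeval_X, eval_X, polyMap]

theorem eval_eq_of_polyMap_eq {v v' : Fin n → ℂ} (h : polyMap f v = polyMap f v')
    {a : MvPolynomial (Fin n) ℂ} (ha : a ∈ subalg f) : eval v a = eval v' a := by
  rw [subalg, Algebra.adjoin_range_eq_range_aeval] at ha
  obtain ⟨F, rfl⟩ := ha
  change eval v (aeval f F) = eval v' (aeval f F)
  rw [eval_aeval_polyMap, eval_aeval_polyMap, h]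

theorem ideal_isMaximal_iff {I : Ideal (MvPolynomial (Fin n) ℂ)} :
    I.IsMaximal ↔ ∃ v : Fin n → ℂ, I = RingHom.ker (eval v) := by
  rw [isMaximal_iff_eq_vanishingIdeal_singleton]
  refine exists_congr fun v => ?_
  have : vanishingIdeal ℂ {v} = RingHom.ker (eval v) := by
    ext p
    rw [mem_vanishingIdeal_singleton_iff, RingHom.mem_ker, ← coe_aeval_eq_eval]
    rfl
  rw [this]

theorem mem_radical_of_forall_eval {I : Ideal (MvPolynomial (Fin n) ℂ)}
    {g : MvPolynomial (Fin n) ℂ} (h : ∀ v, (∀ x ∈ I, eval v x = 0) → eval v g = 0) :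
    g ∈ I.radical := by
  rw [← vanishingIdeal_zeroLocus_eq_radical (K := ℂ), mem_vanishingIdeal_iff]
  intro v hv
  rw [mem_zeroLocus_iff] at hv
  exact h v hv

theorem mem_comap_ker_eval (v : Fin n → ℂ) (a : subalg f) :
    a ∈ (RingHom.ker (eval v)).comap (algebraMap (subalg f) (MvPolynomial (Fin n) ℂ)) ↔
      eval v (a : MvPolynomial (Fin n) ℂ) = 0 := Iff.rfl

section Finite

variable [Module.Finite (subalg f) (MvPolynomial (Fin n) ℂ)]

/-- The zero set of a prime `Q` of `B` maps onto the zero set of the prime `P` of `A` below. -/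
theorem exists_eval_eq_zero {Q : MvPolynomial (Fin n) ℂ} {P : subalg f}
    (h : ∀ x : subalg f, Q ∣ (x : MvPolynomial (Fin n) ℂ) ↔ P ∣ x) {v : Fin n → ℂ}
    (hv : eval v (P : MvPolynomial (Fin n) ℂ) = 0) :
    ∃ v₀, polyMap f v₀ = polyMap f v ∧ eval v₀ Q = 0 := by
  have hmax : (RingHom.ker (eval v)).IsMaximal := ideal_isMaximal_iff.2 ⟨v, rfl⟩
  have hm : ((RingHom.ker (eval v)).under (subalg f)).IsMaximal :=
    Ideal.isMaximal_comap_of_isIntegral_of_isMaximal _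
  obtain ⟨q, hq, hqp, hqu⟩ := Ideal.exists_ideal_over_prime_of_isIntegral
    ((RingHom.ker (eval v)).under (subalg f)) (Ideal.span {Q}) (by
      rw [← Ideal.under_def, under_span_eq h, Ideal.span_singleton_le_iff_mem]
      exact hv)
  have hqm : q.IsMaximal := Ideal.isMaximal_of_isIntegral_of_isMaximal_comap q (by
    rw [hqu]; exact hm)
  obtain ⟨v₀, rfl⟩ := ideal_isMaximal_iff.1 hqm
  refine ⟨v₀, funext fun i => ?_, hq (Ideal.mem_span_singleton_self Q)⟩
  have hmem : f i - C (eval v (f i)) ∈ subalg f :=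
    sub_mem (Algebra.subset_adjoin ⟨i, rfl⟩) ((subalg f).algebraMap_mem _)
  have ha := (mem_comap_ker_eval v ⟨_, hmem⟩).2 (by simp)
  rw [← Ideal.under_def, ← hqu, mem_comap_ker_eval] at ha
  change eval v₀ (f i) = eval v (f i)
  simpa [sub_eq_zero] using ha

theorem mem_ramLocus_iff {v : Fin n → ℂ} : v ∈ ramLocus f ↔ eval v (ramPowProd f) = 0 := by
  constructor
  · intro h
    obtain ⟨g, hg⟩ := jac_dvd_ramPowProd (f := f)
    rw [hg, map_mul, show eval v (jac f) = 0 from h, zero_mul]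
  · intro h
    have := Fintype.ofFinite (Spec1Ram f)
    rw [ramPowProd, finprod_eq_prod_of_fintype, map_prod, Finset.prod_eq_zero_iff] at h
    obtain ⟨q, -, hq⟩ := h
    rw [map_pow] at hq
    obtain ⟨g, hg⟩ := (dvd_jac_iff (prime_rep q)).2 (one_lt_ramIdx_rep q)
    change eval v (jac f) = 0
    rw [hg, map_mul, eq_zero_of_pow_eq_zero hq, zero_mul]

theorem inter_eq_empty_iff {α β : Type*} (g : α → β) (s : Set α) :
    g '' s ∩ g '' sᶜ = ∅ ↔ ∀ v v', g v = g v' → v ∈ s → v' ∈ s := by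
  rw [Set.eq_empty_iff_forall_notMem]
  constructor
  · intro h v v' hvv hv
    by_contra hv'
    exact h (g v) ⟨⟨v, hv, rfl⟩, v', hv', hvv.symm⟩
  · rintro h _ ⟨⟨v, hv, rfl⟩, v', hv', hvv⟩
    exact hv' (h v v' hvv.symm hv)

/-- For the converse, each zero of `Q` shares its fibre with a zero of `Q₀`, where `J` vanishes; so
`J` vanishes on `Q = 0`, and `Q` divides `J`. -/
theorem uniformlyRamified_iff_inter_eq_empty : UniformlyRamified f ↔
    polyMap f '' ramLocus f ∩ polyMap f '' (ramLocus f)ᶜ = ∅ := by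
  rw [inter_eq_empty_iff]
  constructor
  · intro h v v' hvv hv
    rw [mem_ramLocus_iff] at hv ⊢
    rw [← eval_eq_of_polyMap_eq hvv (ramPowProd_mem_iff.2 h), hv]
  · intro h P hP Q₀ Q hQ₀ hQ h₀ hd hram
    rw [← dvd_jac_iff hQ, ← Ideal.mem_span_singleton]
    have hpr : (Ideal.span {Q}).IsPrime := (Ideal.span_singleton_prime hQ.ne_zero).2 hQ
    rw [← hpr.radical]
    refine mem_radical_of_forall_eval fun v hv => ?_
    have hPv : eval v (P : MvPolynomial (Fin n) ℂ) = 0 := hv _ (Ideal.mem_span_singleton.2 hd)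
    obtain ⟨v₀, hv₀, hQv⟩ := exists_eval_eq_zero (dvd_coe_iff hQ₀ hP h₀) hPv
    refine h v₀ v hv₀ ?_
    obtain ⟨g, hg⟩ := (dvd_jac_iff hQ₀).2 hram
    change eval v₀ (jac f) = 0
    rw [hg, map_mul, hQv, zero_mul]

end Finite

/-! ### Interpolation -/

theorem exists_eval_eq_one_and_zero {σ : Type*} (T : Finset (σ → ℂ)) (v : σ → ℂ) :
    ∃ e : MvPolynomial σ ℂ, eval v e = 1 ∧ ∀ t ∈ T, t ≠ v → eval t e = 0 := by
  classical
  have hl : ∀ t : σ → ℂ, ∃ l : MvPolynomial σ ℂ, eval v l = 1 ∧ (t ≠ v → eval t l = 0) := by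
    intro t
    by_cases ht : t = v
    · exact ⟨1, by simp, fun h => absurd ht h⟩
    · obtain ⟨j, hj⟩ := Function.ne_iff.1 ht
      refine ⟨C (v j - t j)⁻¹ * (X j - C (t j)), ?_, fun _ => by simp⟩
      simp [inv_mul_cancel₀ (sub_ne_zero.2 (Ne.symm hj))]
  choose l hl1 hl0 using hl
  refine ⟨∏ t ∈ T, l t, by simp [map_prod, hl1], fun t ht htv => ?_⟩
  rw [map_prod]
  exact Finset.prod_eq_zero ht (hl0 t htv)

theorem exists_eval_eq {σ : Type*} (T : Finset (σ → ℂ)) (c : (σ → ℂ) → ℂ) :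
    ∃ g : MvPolynomial σ ℂ, ∀ t ∈ T, eval t g = c t := by
  choose e he1 he0 using exists_eval_eq_one_and_zero T
  refine ⟨∑ v ∈ T, C (c v) * e v, fun t ht => ?_⟩
  rw [map_sum, Finset.sum_eq_single t]
  · simp [he1]
  · intro v _ hv
    rw [map_mul, he0 v t ht hv.symm, mul_zero]
  · exact fun h => absurd ht h

theorem exists_injOn_eval {σ : Type*} (T : Finset (σ → ℂ)) :
    ∃ g : MvPolynomial σ ℂ, Set.InjOn (fun t => eval t g) (T : Set (σ → ℂ)) := by
  classical
  obtain ⟨g, hg⟩ := exists_eval_eq T fun t => if h : t ∈ T then ((T.equivFin ⟨t, h⟩ : ℕ) : ℂ) else 0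
  refine ⟨g, fun s hs t ht hst => ?_⟩
  simp only [hg s hs, hg t ht, dif_pos (Finset.mem_coe.1 hs), dif_pos (Finset.mem_coe.1 ht)] at hst
  have h1 := T.equivFin.injective (Fin.ext (Nat.cast_injective hst))
  exact congrArg Subtype.val h1

theorem exists_injOn_eval_dir_ne_zero {σ : Type*} [Fintype σ] (T : Finset (σ → ℂ)) (v : σ → ℂ)
    {w : σ → ℂ} (hw : w ≠ 0) : ∃ g : MvPolynomial σ ℂ,
      Set.InjOn (fun t => eval t g) (T : Set (σ → ℂ)) ∧ dir (eval v) w g ≠ 0 := by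
  obtain ⟨g, hg⟩ := exists_injOn_eval T
  by_cases h0 : dir (eval v) w g = 0
  swap
  · exact ⟨g, hg, h0⟩
  obtain ⟨j, hj⟩ := Function.ne_iff.1 hw
  obtain ⟨e, he1, he0⟩ := exists_eval_eq_one_and_zero T v
  -- The added term vanishes on `T`, while its derivative at `v` along `w` is `w j ≠ 0`.
  refine ⟨g + e * (X j - C (v j)), hg.congr fun t ht => ?_, ?_⟩
  · by_cases htv : t = v
    · simp [htv]
    · simp [he0 t ht htv]
  · rw [dir_add, h0, dir_mul, dir_sub, dir_X, dir_C, he1]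
    simpa using hj

/-! ### The branch locus -/

attribute [local instance] FractionRing.liftAlgebra in
theorem natDegree_minpoly_le_finrank {R S : Type*} [CommRing R] [IsDomain R] [IsIntegrallyClosed R]
    [CommRing S] [IsDomain S] [Algebra R S] [FaithfulSMul R S] [Module.Finite R S] (g : S) :
    (minpoly R g).natDegree ≤ Module.finrank R S := by
  have h1 := minpoly.isIntegrallyClosed_eq_field_fractions (FractionRing R) (FractionRing S)
    (Algebra.IsIntegral.isIntegral (R := R) g)
  have h2 := minpoly.natDegree_le (A := FractionRing R) (algebraMap S (FractionRing S) g)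
  rwa [h1, (minpoly.monic (Algebra.IsIntegral.isIntegral g)).natDegree_map,
    IsFractionRing.finrank_eq R (FractionRing R) S (FractionRing S)] at h2

section Finite

variable [Module.Finite (subalg f) (MvPolynomial (Fin n) ℂ)]

theorem degree_pos : 0 < degree f := Module.finrank_pos

/-- The fibre through a point of the ramification locus has fewer than `r` points. -/
theorem polyMap_mem_branchLocus {v : Fin n → ℂ} (hv : v ∈ ramLocus f) :
    polyMap f v ∈ branchLocus f := by
  classical
  by_contra hlt
  have hle : (degree f : ℕ∞) ≤ (polyMap f ⁻¹' {polyMap f v}).encard := not_lt.1 hlt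
  obtain ⟨T, hvT, hTf, hcard⟩ := Set.exists_superset_subset_encard_eq
    (s := {v}) (t := polyMap f ⁻¹' {polyMap f v}) (k := degree f) (by simp)
    (by rw [Set.encard_singleton]; exact_mod_cast degree_pos) hle
  lift T to Finset (Fin n → ℂ) using Set.finite_of_encard_eq_coe hcard
  rw [Set.encard_coe_eq_coe_finsetCard, Nat.cast_inj] at hcard
  obtain ⟨w, hw, hA⟩ := exists_dir_eq_zero (eval v) (f := f) hv
  -- The minimal polynomial of `g` over `A` has degree at most `r`. Specialised at the image point,
  -- it has the `r` distinct roots `g(t)`, and `g(v)` will be a double root: one root too many.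
  obtain ⟨g, hinj, hg⟩ := exists_injOn_eval_dir_ne_zero T v hw
  have hint : IsIntegral (subalg f) g := Algebra.IsIntegral.isIntegral g
  let ψ : subalg f →+* ℂ := (eval v).comp (algebraMap (subalg f) (MvPolynomial (Fin n) ℂ))
  have hmap : ∀ t ∈ T, ∀ p : Polynomial (subalg f),
      (p.map ψ).eval (eval t g) = eval t (Polynomial.aeval g p) := by
    intro t ht p
    have hψ : ψ = (eval t).comp (algebraMap (subalg f) (MvPolynomial (Fin n) ℂ)) :=
      RingHom.ext fun a => (eval_eq_of_polyMap_eq (hTf ht) a.2).symm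
    rw [hψ, Polynomial.eval_map, Polynomial.aeval_def, Polynomial.hom_eval₂]
  have hvT' : v ∈ T := hvT rfl
  set m := minpoly (subalg f) g with hm
  have hroot : ∀ t ∈ T, (m.map ψ).eval (eval t g) = 0 := by
    intro t ht
    rw [hmap t ht, hm, minpoly.aeval, map_zero]
  have hder : (m.map ψ).derivative.eval (eval v g) = 0 := by
    rw [Polynomial.derivative_map, hmap v hvT']
    have h1 := dir_aeval hA m g
    rw [hm, minpoly.aeval, dir_zero] at h1
    exact (mul_eq_zero.1 h1.symm).resolve_right hg
  obtain ⟨p, hp⟩ := Polynomial.dvd_iff_isRoot.2 (hroot v hvT')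
  have hpv : p.eval (eval v g) = 0 := by
    rw [hp] at hder
    simpa using hder
  have hpt : ∀ t : T, p.eval (eval t.1 g) = 0 := by
    rintro ⟨t, ht⟩
    by_cases htv : t = v
    · simpa only [htv] using hpv
    · have h1 := hroot t ht
      rw [hp, Polynomial.eval_mul] at h1
      refine (mul_eq_zero.1 h1).resolve_left ?_
      rw [Polynomial.eval_sub, Polynomial.eval_X, Polynomial.eval_C, sub_eq_zero]
      exact fun h => htv (hinj ht hvT' h)
  have hmonic : (m.map ψ).Monic := (minpoly.monic hint).map ψ
  have hp0 : p ≠ 0 := by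
    rintro rfl
    exact hmonic.ne_zero (by rw [hp, mul_zero])
  refine hp0 (Polynomial.eq_zero_of_natDegree_lt_card_of_eval_eq_zero p
    (f := fun t : T => eval t.1 g) (fun s t hst => Subtype.ext (hinj s.2 t.2 hst)) hpt ?_)
  have h1 := congrArg Polynomial.natDegree hp
  rw [Polynomial.natDegree_mul (Polynomial.X_sub_C_ne_zero _) hp0, Polynomial.natDegree_X_sub_C,
    (minpoly.monic hint).natDegree_map] at h1
  have h2 := natDegree_minpoly_le_finrank (R := subalg f) g
  change _ ≤ degree f at h2
  rw [Fintype.card_coe, hcard]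
  omega

end Finite

/-- Multiplication by `r` embeds `M` in the span. This is the form that Nakayama's lemma supplies
over a non-local ring. -/
theorem finrank_le_card_of_smul_mem_span {R M : Type*} [CommRing R] [IsDomain R] [AddCommGroup M]
    [Module R M] [Module.IsTorsionFree R M] {r : R} (hr : r ≠ 0) (s : Finset M)
    (h : ∀ x : M, r • x ∈ Submodule.span R (s : Set M)) : Module.finrank R M ≤ s.card := by
  let φ : M →ₗ[R] Submodule.span R (s : Set M) :=
    LinearMap.codRestrict _ (LinearMap.lsmul R M r) h
  have hφ : Function.Injective φ := fun x y hxy =>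
    smul_right_injective M hr (congrArg Subtype.val hxy)
  have : Module.Finite R (Submodule.span R (s : Set M)) := Module.Finite.span_finset R s
  exact (LinearMap.finrank_le_finrank_of_injective hφ).trans (finrank_span_finset_le_card s)

/-- The Taylor expansion of order one. -/
theorem mem_ker_eval_mul_self {σ : Type*} [Finite σ] {v : σ → ℂ} {g : MvPolynomial σ ℂ}
    (h0 : eval v g = 0) (h1 : ∀ j, eval v (pderiv j g) = 0) :
    g ∈ RingHom.ker (eval v) * RingHom.ker (eval v) := by
  classical
  have := Fintype.ofFinite σ
  have key : ∀ g : MvPolynomial σ ℂ, g - C (eval v g) -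
      ∑ j, C (eval v (pderiv j g)) * (X j - C (v j)) ∈ RingHom.ker (eval v) * RingHom.ker (eval v) := by
    intro g
    induction g using MvPolynomial.induction_on with
    | C c => simp
    | add p q hp hq =>
      convert! add_mem hp hq using 1
      simp only [map_add, add_mul, Finset.sum_add_distrib]
      ring
    | mul_X p k hp =>
      have h2 : (p - C (eval v p)) * (X k - C (v k)) ∈ RingHom.ker (eval v) * RingHom.ker (eval v) :=
        Ideal.mul_mem_mul (by simp [RingHom.mem_ker]) (by simp [RingHom.mem_ker])
      convert! add_mem (Ideal.mul_mem_left _ (C (v k)) hp) h2 using 1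
      have h3 : ∀ j, C (eval v (pderiv j (p * X k))) * (X j - C (v j)) =
          C (v k) * (C (eval v (pderiv j p)) * (X j - C (v j))) +
            if j = k then C (eval v p) * (X k - C (v k)) else 0 := by
        intro j
        split_ifs with hjk
        · subst hjk
          simp only [pderiv_mul, pderiv_X_self, map_add, map_mul, eval_X, mul_one]
          ring
        · rw [pderiv_mul, pderiv_X_of_ne (Ne.symm hjk), mul_zero, add_zero, map_mul, eval_X, map_mul]
          ring
      simp only [h3, Finset.sum_add_distrib, ← Finset.mul_sum, Finset.sum_ite_eq',
        Finset.mem_univ, if_true, map_mul, eval_X]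
      ring
  simpa [h0, h1] using key g

/-- The ideal of `B` generated by the equations of the fibre over `u`. -/
def fibreIdeal (f : Fin n → MvPolynomial (Fin n) ℂ) (u : Fin n → ℂ) : Ideal (MvPolynomial (Fin n) ℂ) :=
  Ideal.span (Set.range fun i => f i - C (u i))

theorem eval_eq_zero_of_mem_fibreIdeal {u v : Fin n → ℂ} :
    (∀ x ∈ fibreIdeal f u, eval v x = 0) ↔ polyMap f v = u := by
  constructor
  · intro h
    funext i
    have := h _ (Ideal.subset_span ⟨i, rfl⟩)
    change eval v (f i) = u i
    simpa [sub_eq_zero] using this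
  · rintro rfl x hx
    have : fibreIdeal f (polyMap f v) ≤ RingHom.ker (eval v) := by
      rw [fibreIdeal, Ideal.span_le]
      rintro _ ⟨i, rfl⟩
      simp [polyMap]
    exact this hx

/-- Where `J ≠ 0` the gradients of the `f i` form a basis, so a combination of the `f i - u i`
matches `g` to first order. -/
theorem mem_fibreIdeal_sup {u v : Fin n → ℂ} (hv : eval v (jac f) ≠ 0) (hu : polyMap f v = u)
    {g : MvPolynomial (Fin n) ℂ} (hg : eval v g = 0) :
    g ∈ fibreIdeal f u ⊔ RingHom.ker (eval v) * RingHom.ker (eval v) := by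
  rw [map_jac] at hv
  obtain ⟨c, hc⟩ := (Matrix.vecMul_surjective_iff_isUnit.2
    ((Matrix.isUnit_iff_isUnit_det _).2 (isUnit_iff_ne_zero.2 hv)))
    (fun j => eval v (pderiv j g))
  subst hu
  rw [Submodule.mem_sup]
  refine ⟨∑ i, C (c i) * (f i - C (polyMap f v i)), sum_mem fun i _ =>
    Ideal.mul_mem_left _ _ (Ideal.subset_span ⟨i, rfl⟩),
    g - ∑ i, C (c i) * (f i - C (polyMap f v i)), ?_, by ring⟩
  refine mem_ker_eval_mul_self (by simp [hg, polyMap]) fun j => ?_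
  have := congrFun hc j
  simp only [Matrix.vecMul, dotProduct, RingHom.mapMatrix_apply, Matrix.map_apply, jacMatrix,
    Matrix.of_apply] at this
  simp [← this]

/-- An unramified fibre is reduced: `M ≤ I + M ^ 2` at each point gives `M ≤ I + M ^ k` for all `k ≥
1`, and some power of `M` lies in `I`. -/
theorem mem_fibreIdeal_of_forall_eval {u : Fin n → ℂ} {T : Finset (Fin n → ℂ)}
    (hT : ∀ v, v ∈ T ↔ polyMap f v = u) (hjac : ∀ v ∈ T, eval v (jac f) ≠ 0)
    {g : MvPolynomial (Fin n) ℂ} (hg : ∀ v ∈ T, eval v g = 0) : g ∈ fibreIdeal f u := by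
  classical
  set I := fibreIdeal f u with hI
  let M : Ideal (MvPolynomial (Fin n) ℂ) := ⨅ v ∈ T, RingHom.ker (eval v)
  have hM : ∀ x, x ∈ M ↔ ∀ v ∈ T, eval v x = 0 := by
    intro x
    simp [M, Submodule.mem_iInf, RingHom.mem_ker]
  have hrad : M ≤ I.radical := fun x hx => mem_radical_of_forall_eval fun v hv =>
    (hM x).1 hx v ((hT v).2 (eval_eq_zero_of_mem_fibreIdeal.1 hv))
  obtain ⟨N, hN⟩ := Ideal.exists_pow_le_of_le_radical_of_fg hrad (IsNoetherian.noetherian M)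
  have hsup : M ≤ I ⊔ M * M := by
    intro h hh
    rw [hM] at hh
    choose e he1 he0 using exists_eval_eq_one_and_zero T
    -- A partition of unity on the fibre; the `e v` are squared so that `e v * e v` carries the
    -- square of the maximal ideal at `v` into `M * M`.
    have h1 : h = h * (1 - ∑ v ∈ T, e v * e v) + ∑ v ∈ T, e v * e v * h := by
      rw [← Finset.sum_mul]; ring
    rw [h1]
    refine add_mem ?_ (sum_mem fun v hv => ?_)
    · refine Ideal.mem_sup_right (Ideal.mul_mem_mul ((hM h).2 hh) ((hM _).2 fun t ht => ?_))
      rw [map_sub, map_one, map_sum, Finset.sum_eq_single t]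
      · simp [he1]
      · intro v _ hvt
        rw [map_mul, he0 v t ht hvt.symm, mul_zero]
      · exact fun h => absurd ht h
    · obtain ⟨a, ha, k, hk, hak⟩ := Submodule.mem_sup.1
        (mem_fibreIdeal_sup (hjac v hv) ((hT v).1 hv) (hh v hv))
      rw [← hak, mul_add]
      refine add_mem (Ideal.mem_sup_left (Ideal.mul_mem_left _ _ ha)) (Ideal.mem_sup_right ?_)
      have h2 : Ideal.span {e v} * RingHom.ker (eval v) ≤ M := by
        rw [Ideal.span_singleton_mul_le_iff]
        intro z hz
        rw [hM]
        intro t ht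
        by_cases htv : t = v
        · rw [htv, map_mul, RingHom.mem_ker.1 hz, mul_zero]
        · rw [map_mul, he0 v t ht htv, zero_mul]
      refine Ideal.mul_mono h2 h2 ?_
      rw [mul_mul_mul_comm]
      exact Ideal.mul_mem_mul
        (Ideal.mul_mem_mul (Ideal.mem_span_singleton_self _) (Ideal.mem_span_singleton_self _)) hk
  have hpow : ∀ k, M ≤ I ⊔ M ^ (k + 1) := by
    intro k
    induction k with
    | zero => simp
    | succ k ih =>
      refine hsup.trans (sup_le le_sup_left ?_)
      calc M * M ≤ M * (I ⊔ M ^ (k + 1)) := Ideal.mul_mono_right ih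
        _ = M * I ⊔ M ^ (k + 1 + 1) := by rw [Ideal.mul_sup, ← pow_succ']
        _ ≤ I ⊔ M ^ (k + 1 + 1) := sup_le_sup_right Ideal.mul_le_right _
  exact ((hpow N).trans (sup_le le_rfl ((Ideal.pow_le_pow_right N.le_succ).trans hN))) ((hM g).2 hg)

section Finite

variable [Module.Finite (subalg f) (MvPolynomial (Fin n) ℂ)]

/-- The fibre being reduced, the interpolators `e v` span `B` modulo `𝔪 B`. By Nakayama some `r ≡ 1`
modulo `𝔪`, hence nonzero, multiplies `B` into their `A`-span. -/
theorem degree_le_card {w : Fin n → ℂ} {T : Finset (Fin n → ℂ)}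
    (hT : ∀ v, v ∈ T ↔ polyMap f v = polyMap f w) (hjac : ∀ v ∈ T, eval v (jac f) ≠ 0) :
    degree f ≤ T.card := by
  classical
  choose e he1 he0 using exists_eval_eq_one_and_zero T
  let s : Finset (MvPolynomial (Fin n) ℂ) := T.image e
  let N : Submodule (subalg f) (MvPolynomial (Fin n) ℂ) := Submodule.span (subalg f) s
  let 𝔪 : Ideal (subalg f) := (RingHom.ker (eval w)).comap (algebraMap (subalg f) (MvPolynomial (Fin n) ℂ))
  have hle : (⊤ : Submodule (subalg f) (MvPolynomial (Fin n) ℂ)) ≤ N ⊔ 𝔪 • ⊤ := by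
    intro g _
    have h1 : g - ∑ v ∈ T, C (eval v g) * e v ∈ fibreIdeal f (polyMap f w) := by
      refine mem_fibreIdeal_of_forall_eval hT hjac fun t ht => ?_
      rw [map_sub, map_sum, Finset.sum_eq_single t]
      · simp [he1]
      · intro v _ hvt
        rw [map_mul, he0 v t ht hvt.symm, mul_zero]
      · exact fun h => absurd ht h
    have h2 : ∑ v ∈ T, C (eval v g) * e v ∈ N := by
      refine sum_mem fun v hv => ?_
      exact N.smul_mem (algebraMap ℂ (subalg f) (eval v g))
        (Submodule.subset_span (Finset.mem_coe.2 (Finset.mem_image_of_mem e hv)))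
    have h3 : ∀ x ∈ fibreIdeal f (polyMap f w),
        x ∈ (𝔪 • ⊤ : Submodule (subalg f) (MvPolynomial (Fin n) ℂ)) := by
      intro x hx
      induction hx using Submodule.span_induction with
      | mem x hx =>
        obtain ⟨i, rfl⟩ := hx
        have hmem : f i - C (polyMap f w i) ∈ subalg f :=
          sub_mem (Algebra.subset_adjoin ⟨i, rfl⟩) ((subalg f).algebraMap_mem _)
        have h4 := Submodule.smul_mem_smul (N := (⊤ : Submodule (subalg f) (MvPolynomial (Fin n) ℂ)))
          ((mem_comap_ker_eval w ⟨_, hmem⟩).2 (by simp [polyMap])) (Submodule.mem_top (x := 1))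
        rwa [Algebra.smul_def, mul_one] at h4
      | zero => exact zero_mem _
      | add x y _ _ hx hy => exact add_mem hx hy
      | smul c x _ hx =>
        rw [smul_eq_mul]
        refine Submodule.smul_induction_on hx (fun r hr y _ => ?_) fun y z hy hz => ?_
        · rw [mul_smul_comm]
          exact Submodule.smul_mem_smul hr Submodule.mem_top
        · rw [mul_add]
          exact add_mem hy hz
    rw [← add_sub_cancel (∑ v ∈ T, C (eval v g) * e v) g]
    exact add_mem (Submodule.mem_sup_left h2) (Submodule.mem_sup_right (h3 _ h1))
  obtain ⟨r, hr, hrN⟩ := Submodule.exists_sub_one_mem_and_smul_le_of_fg_of_le_sup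
    (Module.Finite.fg_top) le_top hle
  have hr0 : r ≠ 0 := by
    rintro rfl
    have := (mem_comap_ker_eval w _).1 hr
    simp at this
  exact (finrank_le_card_of_smul_mem_span hr0 s fun x =>
    hrN (Submodule.smul_mem_pointwise_smul x r ⊤ Submodule.mem_top)).trans Finset.card_image_le

/-- A fibre with fewer than `r` points meets the ramification locus. -/
theorem exists_mem_ramLocus {w : Fin n → ℂ} (hw : polyMap f w ∈ branchLocus f) :
    ∃ v ∈ ramLocus f, polyMap f v = polyMap f w := by
  by_contra! h
  have hlt : (polyMap f ⁻¹' {polyMap f w}).encard < (degree f : ℕ∞) := hw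
  have hfin : (polyMap f ⁻¹' {polyMap f w}).Finite := Set.finite_of_encard_le_coe hlt.le
  have h1 := degree_le_card (f := f) (w := w) (T := hfin.toFinset) (by simp) fun v hv hv0 =>
    h v hv0 (by simpa using hv)
  rw [hfin.encard_eq_coe_toFinset_card, Nat.cast_lt] at hlt
  omega

/-- Both sides say that the ramification locus is a union of fibres. -/
theorem preimage_branchLocus_eq_iff : polyMap f ⁻¹' branchLocus f = ramLocus f ↔
    polyMap f '' ramLocus f ∩ polyMap f '' (ramLocus f)ᶜ = ∅ := by
  rw [inter_eq_empty_iff]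
  constructor
  · intro h v v' hvv hv
    rw [← h, Set.mem_preimage] at hv ⊢
    rwa [← hvv]
  · intro h
    ext v
    refine ⟨fun hv => ?_, fun hv => polyMap_mem_branchLocus hv⟩
    obtain ⟨v', hv', hvv⟩ := exists_mem_ramLocus hv
    exact h v' v hvv hv'

end Finite

end PolyExt

end

theorem mainTheorem2 {n : ℕ} (hn : 0 < n) (b a : Fin n → ℕ)
    (f : Fin n → MvPolynomial (Fin n) ℂ) (hf : PolyExt.IsFiniteGraded b a f) :
    (PolyExt.Spec1Ram f).Finite ∧
    List.TFAE
      [ PolyExt.WellRamified f,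
        PolyExt.ContractsTo f (PolyExt.ramProd f) (PolyExt.ramPowProd f),
        PolyExt.ramPowProd f ∈ PolyExt.subalg f,
        ∀ p ∈ PolyExt.Spec1 (PolyExt.subalg f),
          (∃ q₀ ∈ PolyExt.Spec1 (MvPolynomial (Fin n) ℂ),
            q₀.under (PolyExt.subalg f) = p ∧ 1 < PolyExt.ramIdx f q₀) →
          ∀ q ∈ PolyExt.Spec1 (MvPolynomial (Fin n) ℂ),
            q.under (PolyExt.subalg f) = p → 1 < PolyExt.ramIdx f q,
        ∀ P : PolyExt.subalg f, Irreducible P →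
          Squarefree (P : MvPolynomial (Fin n) ℂ) ∨
            PolyExt.CompletelyNonReduced (P : MvPolynomial (Fin n) ℂ),
        PolyExt.polyMap f ⁻¹' PolyExt.branchLocus f = PolyExt.ramLocus f,
        PolyExt.polyMap f '' PolyExt.ramLocus f ∩
          PolyExt.polyMap f '' (PolyExt.ramLocus f)ᶜ = ∅ ] := by
  have := hf.finite
  refine ⟨PolyExt.finite_Spec1Ram f, ?_⟩
  rw [PolyExt.wellRamified_iff, PolyExt.contractsTo_ramProd_iff, ← PolyExt.uniformlyRamified_iff,
    ← PolyExt.uniformlyRamified_iff_squarefree_or, PolyExt.preimage_branchLocus_eq_iff,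
    ← PolyExt.uniformlyRamified_iff_inter_eq_empty, PolyExt.ramPowProd_mem_iff]
  tfae_finish
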